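/- Let $m,n$ be integers with $0<n-m<m$, let $(M,(\,,))$ be a smooth $m$-dimensional Riemannian manifold and let $\varphi:M\to\mathbb{R}^n$ be a smooth isometric immersion, where $\mathbb{R}^n$ carries its flat metric $\langle\,,\rangle$. Let $o\in\mathbb{R}^n$, let $v\in\mathbb{R}^n$ be a unit vector, let $\theta\in(0,\pi/2)$, and assume that $\varphi(M)$ is contained in the non-degenerate cone $$\mathcal{C}_{o,v,\theta}=\Big\{z\in\mathbb{R}^n\setminus\{o\}\ :\ \Big\langle\frac{z-o}{|z-o|},v\Big\rangle\ge\cos\theta\Big\}.$$ Assume that the weak maximum principle for the Hessian holds on $M$: for every $u\in C^2(M)$ with $u^*=\sup_M u<+\infty$ there is a sequence $\{x_k\}_{k\ge1}\subset M$ such that, for every $k\ge 1$, $$u(x_k)>u^*-\frac1k\qquad\text{and}\qquad \sup_{w\in T_{x_k}M,\ |w|=1}\mathrm{Hess}_{x_k}u(w,w)<\frac1k .$$ Assume also that, for some constant $\chi\ge0$, the sectional curvature of every $2$-plane of $T_xM$ is at most $\chi^2$, for every $x\in M$. Let $\pi_v=\{z\in\mathbb{R}^n:\langle z-o,v\rangle=0\}$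 be the hyperplane through $o$ orthogonal to $v$, let $d(\pi_v,\varphi(M))=\inf\{|p-q|:p\in\pi_v,\ q\in\varphi(M)\}$, and let $$A_1=\sup\Big\{\xi\alpha^2\sqrt{1-\alpha^2}\ :\ \xi\in(0,1),\ \alpha\in\big(0,\min\{1,\sqrt{1-\xi}\}\big)\Big\}.$$ Then $$\cos\theta\le\sqrt{d(\pi_v,\varphi(M))\,\frac{\chi}{A_1}}.$$ -/

import Mathlib

open Bundle
open scoped Manifold ContDiff RealInnerProductSpace

noncomputable section

namespace ConeImmersion

/-! ### Levi-Civita connection, Hessian and sectional curvature in the preferred charts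

`M` is a smooth manifold modelled on `ℝ^m`, whose tangent bundle carries a Riemannian metric.
Everything is computed in the preferred chart `extChartAt (𝓡 m) x` at `x`. Mathlib identifies
`TangentSpace (𝓡 m) x` with the model space `ℝ^m` through exactly this chart, so that a tangent
vector at `x` is the vector of its coordinates. -/

section Riemannian

variable {m : ℕ} {M : Type*} [TopologicalSpace M] [ChartedSpace (EuclideanSpace ℝ (Fin m)) M]
  [RiemannianBundle (fun x : M ↦ TangentSpace (𝓡 m) x)]

/-- The coordinate expression, at the point `y` of the model space, of the Riemannian metric in the
preferred chart at `x`: the pull-back of the metric by the inverse of the chart. -/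
def chartMetric (x : M) (y : EuclideanSpace ℝ (Fin m)) :
    EuclideanSpace ℝ (Fin m) →L[ℝ] EuclideanSpace ℝ (Fin m) →L[ℝ] ℝ :=
  let L : EuclideanSpace ℝ (Fin m) →L[ℝ] TangentSpace (𝓡 m) ((extChartAt (𝓡 m) x).symm y) :=
    mfderiv 𝓘(ℝ, EuclideanSpace ℝ (Fin m)) (𝓡 m) (extChartAt (𝓡 m) x).symm y
  (innerSL ℝ (E := TangentSpace (𝓡 m) ((extChartAt (𝓡 m) x).symm y))).bilinearComp L L

/-- The Christoffel symbols of the first kind in the chart at `x`: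
`Γ(a, b; c) = (∂_a g(b, c) + ∂_b g(a, c) - ∂_c g(a, b)) / 2`, as a linear form in `c`. -/
def christoffelFirst (x : M) (y a b : EuclideanSpace ℝ (Fin m)) :
    EuclideanSpace ℝ (Fin m) →L[ℝ] ℝ :=
  let Dg := fderiv ℝ (chartMetric x) y
  (1 / 2 : ℝ) • (Dg a b + Dg b a - (Dg.flip a).flip b)

/-- The Christoffel symbols (of the second kind) of the Levi-Civita connection in the chart at `x`:
`Γ(a, b)` is the vector obtained by raising the last index of `christoffelFirst`, that is
`g(Γ(a, b), c) = Γ(a, b; c)`. -/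
def christoffel (x : M) (y a b : EuclideanSpace ℝ (Fin m)) : EuclideanSpace ℝ (Fin m) :=
  (chartMetric x y).inverse (christoffelFirst x y a b)

/-- The curvature tensor `R(a, b)c = ∇_a ∇_b c - ∇_b ∇_a c` in the chart at `x` (for coordinate
vector fields, which commute):
`R(a, b)c = ∂_a Γ(b, c) - ∂_b Γ(a, c) + Γ(a, Γ(b, c)) - Γ(b, Γ(a, c))`. -/
def chartCurvature (x : M) (y a b c : EuclideanSpace ℝ (Fin m)) : EuclideanSpace ℝ (Fin m) :=
  fderiv ℝ (fun z ↦ christoffel x z b c) y a - fderiv ℝ (fun z ↦ christoffel x z a c) y b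
    + christoffel x y a (christoffel x y b c) - christoffel x y b (christoffel x y a c)

/-- The Riemann curvature tensor `R(a, b)c` of `M` at `x`. -/
def riemannCurvature (x : M) (a b c : TangentSpace (𝓡 m) x) : TangentSpace (𝓡 m) x :=
  chartCurvature x (extChartAt (𝓡 m) x x) a b c

/-- The sectional curvature at `x` of the plane spanned by the linearly independent tangent vectors
`a` and `b`. -/
def sectionalCurvature (x : M) (a b : TangentSpace (𝓡 m) x) : ℝ :=
  ⟪riemannCurvature x a b b, a⟫ / (⟪a, a⟫ * ⟪b, b⟫ - ⟪a, b⟫ ^ 2)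

variable (m M) in
/-- All sectional curvatures of `M` are at most `K`. -/
def SectionalCurvatureLE (K : ℝ) : Prop :=
  ∀ (x : M) (a b : TangentSpace (𝓡 m) x), LinearIndependent ℝ ![a, b] →
    sectionalCurvature x a b ≤ K

/-- The Riemannian Hessian `Hess_x u (a, b) = ∂_a ∂_b u - ∂_{Γ(a, b)} u` of a function `u`. -/
def hessian (u : M → ℝ) (x : M) (a b : TangentSpace (𝓡 m) x) : ℝ :=
  let w : EuclideanSpace ℝ (Fin m) → ℝ := u ∘ (extChartAt (𝓡 m) x).symm
  let y : EuclideanSpace ℝ (Fin m) := extChartAt (𝓡 m) x x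
  fderiv ℝ (fderiv ℝ w) y a b - fderiv ℝ w y (christoffel x y a b)

variable (m M) in
/-- The weak maximum principle for the Hessian operator on `M`. -/
def WeakMaximumPrincipleHessian : Prop :=
  ∀ u : M → ℝ, ContMDiff (𝓡 m) 𝓘(ℝ, ℝ) 2 u → BddAbove (Set.range u) →
    ∃ x : ℕ → M, ∀ k : ℕ, 1 ≤ k →
      (⨆ z, u z) - 1 / (k : ℝ) < u (x k) ∧
      (⨆ v : {v : TangentSpace (𝓡 m) (x k) // ‖v‖ = 1}, hessian u (x k) v.1 v.1) < 1 / (k : ℝ)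

variable (m) in
/-- `φ : M → ℝ^n` is a smooth isometric immersion. -/
structure IsIsometricImmersion {n : ℕ} (φ : M → EuclideanSpace ℝ (Fin n)) : Prop where
  contMDiff : ContMDiff (𝓡 m) (𝓡 n) ∞ φ
  inner_mfderiv : ∀ (x : M) (a b : TangentSpace (𝓡 m) x),
    ⟪mfderiv (𝓡 m) (𝓡 n) φ x a, mfderiv (𝓡 m) (𝓡 n) φ x b⟫ = ⟪a, b⟫

end Riemannian

section Euclidean

variable {n : ℕ}

/-- The cone `C_{o,v,θ}` with vertex `o`, direction `v` and width `θ`, without its vertex. -/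
def cone (o v : EuclideanSpace ℝ (Fin n)) (θ : ℝ) : Set (EuclideanSpace ℝ (Fin n)) :=
  {z | z ≠ o ∧ Real.cos θ ≤ ⟪(‖z - o‖)⁻¹ • (z - o), v⟫}

/-- The hyperplane through `o` orthogonal to `v`. -/
def hyperplane (o v : EuclideanSpace ℝ (Fin n)) : Set (EuclideanSpace ℝ (Fin n)) :=
  {z | ⟪z - o, v⟫ = 0}

/-- The Euclidean distance between two (non-empty) sets. -/
def setDist (S T : Set (EuclideanSpace ℝ (Fin n))) : ℝ :=
  ⨅ p : S × T, dist (p.1 : EuclideanSpace ℝ (Fin n)) p.2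

end Euclidean

/-- The constant `A_η`. -/
def constA (η : ℝ) : ℝ :=
  sSup {t | ∃ ξ ∈ Set.Ioo (0 : ℝ) 1, ∃ α ∈ Set.Ioo (0 : ℝ) (min 1 (η * √(1 - ξ))),
    t = ξ * α ^ 2 * √(1 - α ^ 2)}

end ConeImmersion

end

/-! Fix T > d(π_v, φ(M)), α in (0, 1), and put a = α cos θ, β = √(1 - α²). Test the maximum
principle on u = f ∘ φ, where f(z) = s(z) - ⟪v, z - o⟫ and s(z) = √(T² + a²|z - o|²). The cone
condition gives u ≤ T (`coneFunction_le`), and a point of φ(M) of height less than T makes sup u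
positive. So for large k the maximum principle yields points with u > 0 and Hess u < 1/k.

There Hess u(w, w) = D²f(Dφ w, Dφ w) + Df(II(w, w)), with D²f ≥ a²T²/s³ and |Df| ≤ 1
(`fderiv_fderiv_coneFunction_ge`, `abs_fderiv_coneFunction_le`). Moreover u > 0 forces βs ≤ T. Hence
|II(w, w)| ≥ c|w|² with c = a²β³/T - 1/k.

The codimension n - m is less than m, so Otsuki's lemma
(`exists_orthogonal_of_bilinear_diag_lower_bound`) and the Gauss equation turn this into a plane of
sectional curvature at least c² when c > 0, whence c ≤ χ. Letting k → ∞ gives α²β³cos²θ ≤ χT. Let T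
tend to d, then take the supremum over α: in A₁ the constraint on α says ξ < 1 - α², so A₁ is at
most the supremum of α²β³. -/

namespace ConeImmersion

/-! ### Otsuki's lemma for bilinear maps -/

/-- A polynomial of degree four without constant term that is nonnegative has vanishing linear
coefficient and nonnegative quadratic coefficient. -/
theorem quartic_nonneg_coeff {p q r s : ℝ}
    (h : ∀ t : ℝ, 0 ≤ p * t + q * t ^ 2 + r * t ^ 3 + s * t ^ 4) : p = 0 ∧ 0 ≤ q := by
  have hp : p = 0 := by
    have hd : HasDerivAt (fun t : ℝ ↦ p * t + q * t ^ 2 + r * t ^ 3 + s * t ^ 4) p 0 := by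
      have h1 := ((((hasDerivAt_id (0 : ℝ)).const_mul p).add
        ((hasDerivAt_pow 2 (0 : ℝ)).const_mul q)).add
        ((hasDerivAt_pow 3 (0 : ℝ)).const_mul r)).add ((hasDerivAt_pow 4 (0 : ℝ)).const_mul s)
      exact h1.congr_deriv (by norm_num)
    refine IsLocalMin.hasDerivAt_eq_zero (Filter.Eventually.of_forall fun t ↦ ?_) hd
    simpa using h t
  refine ⟨hp, ?_⟩
  subst hp
  have hlim : Filter.Tendsto (fun t : ℝ ↦ q + r * t + s * t ^ 2) (nhdsWithin 0 (Set.Ioi 0))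
      (nhds q) := by
    have hc : Continuous (fun t : ℝ ↦ q + r * t + s * t ^ 2) := by fun_prop
    simpa using (hc.tendsto 0).mono_left nhdsWithin_le_nhds
  refine ge_of_tendsto hlim ?_
  filter_upwards [self_mem_nhdsWithin] with t ht
  have ht2 : 0 < t ^ 2 := pow_pos ht 2
  refine nonneg_of_mul_nonneg_right ?_ ht2
  have := h t
  nlinarith

/-- **Otsuki's lemma**, quantitative form: a symmetric bilinear map into a space of smaller
dimension, bounded below on the diagonal by `c |w|²`, where `|w| = ‖D w‖`, admits orthogonal
nonzero vectors `x`, `y` with `B(x, y) = 0` and `⟪B(x, x), B(y, y)⟫ ≥ c² |x|² |y|²`. -/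
theorem exists_orthogonal_of_bilinear_diag_lower_bound {V F N : Type*}
    [NormedAddCommGroup V] [NormedSpace ℝ V] [FiniteDimensional ℝ V]
    [NormedAddCommGroup F] [InnerProductSpace ℝ F]
    [NormedAddCommGroup N] [InnerProductSpace ℝ N] [FiniteDimensional ℝ N]
    (hdim : Module.finrank ℝ N < Module.finrank ℝ V)
    (D : V →L[ℝ] F) (hD : Function.Injective D) (B : V →L[ℝ] V →L[ℝ] N)
    (hB : ∀ a b, B a b = B b a) {c : ℝ} (hc : 0 < c) (hlow : ∀ w, c * ‖D w‖ ^ 2 ≤ ‖B w w‖) :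
    ∃ x y : V, x ≠ 0 ∧ y ≠ 0 ∧ ⟪D x, D y⟫ = 0 ∧ B x y = 0 ∧
      c ^ 2 * (‖D x‖ ^ 2 * ‖D y‖ ^ 2) ≤ ⟪B x x, B y y⟫ := by
  have hD0 : ∀ w : V, w ≠ 0 → 0 < ‖D w‖ := fun w hw ↦
    norm_pos_iff.2 fun h ↦ hw (hD (by rw [h, map_zero]))
  have : Nontrivial V := Module.nontrivial_of_finrank_pos (R := ℝ) (by omega)
  have hne : (Metric.sphere (0 : V) 1).Nonempty := NormedSpace.sphere_nonempty.2 zero_le_one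
  have hs0 : ∀ w ∈ Metric.sphere (0 : V) 1, w ≠ 0 := by
    rintro w hw rfl; simp at hw
  -- The quotient is homogeneous of degree 0, so its minimum over the compact sphere is its minimum
  -- over all nonzero vectors.
  obtain ⟨x, hx, hmin⟩ := (isCompact_sphere (0 : V) 1).exists_isMinOn hne
    (f := fun w ↦ ‖B w w‖ ^ 2 / ‖D w‖ ^ 4) (by
      have hBc : Continuous fun w ↦ B w w := B.continuous.clm_apply continuous_id
      refine ContinuousOn.div (hBc.norm.pow 2).continuousOn
        (D.continuous.norm.pow 4).continuousOn fun w hw ↦ ?_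
      exact (pow_pos (hD0 w (hs0 w hw)) 4).ne')
  have hx0 := hs0 x hx
  set e : ℝ := ‖B x x‖ ^ 2 / ‖D x‖ ^ 4 with he
  have hex : ‖B x x‖ ^ 2 = e * ‖D x‖ ^ 4 := by
    rw [he, div_mul_cancel₀ _ (pow_pos (hD0 x hx0) 4).ne']
  have hce : c ^ 2 ≤ e := by
    rw [he, le_div_iff₀ (pow_pos (hD0 x hx0) 4)]
    calc c ^ 2 * ‖D x‖ ^ 4 = (c * ‖D x‖ ^ 2) ^ 2 := by ring
      _ ≤ _ := pow_le_pow_left₀ (by positivity) (hlow x) 2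
  have hall : ∀ w : V, e * ‖D w‖ ^ 4 ≤ ‖B w w‖ ^ 2 := by
    intro w
    rcases eq_or_ne w 0 with rfl | hw
    · simp
    have hw' : ‖w‖ ≠ 0 := norm_ne_zero_iff.2 hw
    have hmem : ‖w‖⁻¹ • w ∈ Metric.sphere (0 : V) 1 := by
      simp [norm_smul, hw']
    have h1 : e ≤ ‖B (‖w‖⁻¹ • w) (‖w‖⁻¹ • w)‖ ^ 2 / ‖D (‖w‖⁻¹ • w)‖ ^ 4 := hmin hmem
    have h2 : ‖B (‖w‖⁻¹ • w) (‖w‖⁻¹ • w)‖ ^ 2 / ‖D (‖w‖⁻¹ • w)‖ ^ 4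
        = ‖B w w‖ ^ 2 / ‖D w‖ ^ 4 := by
      have := (hD0 w hw).ne'
      simp only [map_smul, smul_apply, norm_smul, norm_inv, norm_norm]
      field_simp
    rw [h2, le_div_iff₀ (pow_pos (hD0 w hw) 4)] at h1
    exact h1
  obtain ⟨y, hyker, hy0⟩ : ∃ y ∈ LinearMap.ker (B x : V →ₗ[ℝ] N), y ≠ 0 := by
    refine Submodule.exists_mem_ne_zero_of_ne_bot fun hbot ↦ ?_
    exact absurd (LinearMap.finrank_le_finrank_of_injective (LinearMap.ker_eq_bot.1 hbot))
      (not_le.2 hdim)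
  have hxy : B x y = 0 := hyker
  have hyx : B y x = 0 := by rw [hB, hxy]
  -- Minimality at x along the line x + t y: the expansion of ‖B(x + ty, x + ty)‖² - e‖D(x + ty)‖⁴,
  -- whose constant term vanishes. The linear coefficient will give orthogonality, the quadratic one
  -- the lower bound.
  have hpoly : ∀ t : ℝ, 0 ≤ (-4 * e * ‖D x‖ ^ 2 * ⟪D x, D y⟫) * t
      + (2 * ⟪B x x, B y y⟫ - e * (2 * ‖D x‖ ^ 2 * ‖D y‖ ^ 2 + 4 * ⟪D x, D y⟫ ^ 2)) * t ^ 2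
      + (-4 * e * ⟪D x, D y⟫ * ‖D y‖ ^ 2) * t ^ 3
      + (‖B y y‖ ^ 2 - e * ‖D y‖ ^ 4) * t ^ 4 := by
    intro t
    have h1 := hall (x + t • y)
    have h2 : B (x + t • y) (x + t • y) = B x x + t ^ 2 • B y y := by
      simp only [map_add, map_smul, add_apply,
        smul_apply, hxy, hyx, smul_zero, add_zero, zero_add, smul_smul, sq]
    have h3 : ‖B x x + t ^ 2 • B y y‖ ^ 2
        = ‖B x x‖ ^ 2 + 2 * (t ^ 2 * ⟪B x x, B y y⟫) + t ^ 4 * ‖B y y‖ ^ 2 := by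
      rw [norm_add_sq_real, inner_smul_right, norm_smul, mul_pow, Real.norm_eq_abs, sq_abs]
      ring
    have h4 : ‖D (x + t • y)‖ ^ 2 = ‖D x‖ ^ 2 + 2 * (t * ⟪D x, D y⟫) + t ^ 2 * ‖D y‖ ^ 2 := by
      rw [map_add, map_smul, norm_add_sq_real, inner_smul_right, norm_smul, mul_pow,
        Real.norm_eq_abs, sq_abs]
    have h5 : ‖D (x + t • y)‖ ^ 4 = (‖D (x + t • y)‖ ^ 2) ^ 2 := by ring
    rw [h2, h3, h5, h4, hex] at h1
    linarith
  obtain ⟨hp, hq⟩ := quartic_nonneg_coeff hpoly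
  have hepos : 0 < e := (pow_pos hc 2).trans_le hce
  have horth : ⟪D x, D y⟫ = 0 := by
    have h1 := hD0 x hx0
    have h2 : -4 * e * ‖D x‖ ^ 2 ≠ 0 := by
      have : 0 < e * ‖D x‖ ^ 2 := by positivity
      nlinarith
    exact (mul_eq_zero.1 hp).resolve_left h2
  refine ⟨x, y, hx0, hy0, horth, hxy, ?_⟩
  rw [horth] at hq
  have : c ^ 2 * (‖D x‖ ^ 2 * ‖D y‖ ^ 2) ≤ e * (‖D x‖ ^ 2 * ‖D y‖ ^ 2) := by gcongr
  linarith

/-! ### Second-order calculus in a chart -/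

section Local

variable {E F : Type*} [NormedAddCommGroup E] [NormedSpace ℝ E]
  [NormedAddCommGroup F]

section NormedSpace

variable [NormedSpace ℝ F]

theorem differentiableAt_fderiv_of_contDiffOn {Φ : E → F} {s : Set E} (hs : IsOpen s)
    (hΦ : ContDiffOn ℝ ∞ Φ s) {z : E} (hz : z ∈ s) : DifferentiableAt ℝ (fderiv ℝ Φ) z :=
  ((hΦ.fderiv_of_isOpen (m := ∞) hs (by simp)).contDiffAt (hs.mem_nhds hz)).differentiableAt
    (by simp)

theorem differentiableAt_fderiv_fderiv_of_contDiffOn {Φ : E → F} {s : Set E} (hs : IsOpen s)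
    (hΦ : ContDiffOn ℝ ∞ Φ s) {z : E} (hz : z ∈ s) :
    DifferentiableAt ℝ (fderiv ℝ (fderiv ℝ Φ)) z :=
  (((hΦ.fderiv_of_isOpen (m := ∞) hs (by simp)).fderiv_of_isOpen (m := ∞) hs
    (by simp)).contDiffAt (hs.mem_nhds hz)).differentiableAt (by simp)

theorem fderiv_fderiv_comm_of_contDiffOn {Φ : E → F} {s : Set E} (hs : IsOpen s)
    (hΦ : ContDiffOn ℝ ∞ Φ s) {z : E} (hz : z ∈ s) (a b : E) :
    fderiv ℝ (fderiv ℝ Φ) z a b = fderiv ℝ (fderiv ℝ Φ) z b a :=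
  (hΦ.contDiffAt (hs.mem_nhds hz)).isSymmSndFDerivAt
    (by rw [minSmoothness_of_isRCLikeNormedField]; exact ENat.LEInfty.out) a b

theorem fderiv_fderiv_apply {Φ : E → F} {z : E} (h : DifferentiableAt ℝ (fderiv ℝ Φ) z) (a b : E) :
    fderiv ℝ (fun y ↦ fderiv ℝ Φ y b) z a = fderiv ℝ (fderiv ℝ Φ) z a b := by
  rw [fderiv_clm_apply h (differentiableAt_const b)]
  simp

/-- The second derivative of a composition with a real function. -/
theorem fderiv_fderiv_comp {f : F → ℝ} (hf : ContDiff ℝ 2 f) {Φ : E → F} {s : Set E}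
    (hs : IsOpen s) (hΦ : ContDiffOn ℝ ∞ Φ s) {z : E} (hz : z ∈ s) (a b : E) :
    fderiv ℝ (fderiv ℝ (f ∘ Φ)) z a b
      = fderiv ℝ (fderiv ℝ f) (Φ z) (fderiv ℝ Φ z a) (fderiv ℝ Φ z b)
        + fderiv ℝ f (Φ z) (fderiv ℝ (fderiv ℝ Φ) z a b) := by
  have hd : ∀ y ∈ s, DifferentiableAt ℝ Φ y := fun y hy ↦
    (hΦ.contDiffAt (hs.mem_nhds hy)).differentiableAt (by simp)
  have hD := differentiableAt_fderiv_of_contDiffOn hs hΦ hz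
  have hfd : Differentiable ℝ f := hf.differentiable (by simp)
  have hfD : Differentiable ℝ (fderiv ℝ f) :=
    (hf.fderiv_right (m := 1) (by norm_num)).differentiable (by simp)
  have he : fderiv ℝ (f ∘ Φ) =ᶠ[nhds z] fun y ↦ (fderiv ℝ f (Φ y)).comp (fderiv ℝ Φ y) := by
    filter_upwards [hs.mem_nhds hz] with y hy using fderiv_comp y (hfd _) (hd y hy)
  have hcomp : HasFDerivAt (fun y ↦ fderiv ℝ f (Φ y))
      ((fderiv ℝ (fderiv ℝ f) (Φ z)).comp (fderiv ℝ Φ z)) z :=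
    (hfD _).hasFDerivAt.comp z (hd z hz).hasFDerivAt
  rw [he.fderiv_eq, (hcomp.clm_comp hD.hasFDerivAt).fderiv]
  simp [add_comm]

theorem differentiableAt_clm_inverse {X : Type*} [NormedAddCommGroup X] [NormedSpace ℝ X]
    [CompleteSpace E] {G : X → E →L[ℝ] F} {z : X} (hG : DifferentiableAt ℝ G z)
    (hinv : (G z).IsInvertible) : DifferentiableAt ℝ (fun y ↦ (G y).inverse) z :=
  DifferentiableAt.comp z
    ((hinv.contDiffAt_map_inverse (n := 1)).differentiableAt (by simp)) hG

end NormedSpace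

variable [InnerProductSpace ℝ F]

/-- The derivative of the metric induced by `Φ`. -/
theorem fderiv_inner_fderiv {Φ : E → F} {z : E} (h : DifferentiableAt ℝ (fderiv ℝ Φ) z)
    (a b c : E) :
    fderiv ℝ (fun y ↦ ⟪fderiv ℝ Φ y b, fderiv ℝ Φ y c⟫) z a
      = ⟪fderiv ℝ (fderiv ℝ Φ) z a b, fderiv ℝ Φ z c⟫
        + ⟪fderiv ℝ Φ z b, fderiv ℝ (fderiv ℝ Φ) z a c⟫ := by
  rw [fderiv_inner_apply ℝ (h.clm_apply (differentiableAt_const b))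
    (h.clm_apply (differentiableAt_const c)), fderiv_fderiv_apply h, fderiv_fderiv_apply h]
  ring

end Local

/-! ### The induced metric and its Christoffel symbols -/

section Gauss

variable {m n : ℕ} {M : Type*} [TopologicalSpace M] [ChartedSpace (EuclideanSpace ℝ (Fin m)) M]

/-- The expression of a map `φ : M → ℝ^n` in the preferred chart at `x`. -/
noncomputable def localRep (φ : M → EuclideanSpace ℝ (Fin n)) (x : M) :
    EuclideanSpace ℝ (Fin m) → EuclideanSpace ℝ (Fin n) :=
  φ ∘ (extChartAt (𝓡 m) x).symm

theorem contDiffOn_localRep [IsManifold (𝓡 m) ∞ M] {φ : M → EuclideanSpace ℝ (Fin n)}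
    (hφ : ContMDiff (𝓡 m) (𝓡 n) ∞ φ) (x : M) :
    ContDiffOn ℝ ∞ (localRep φ x) (extChartAt (𝓡 m) x).target := by
  rw [← contMDiffOn_iff_contDiffOn]
  exact hφ.comp_contMDiffOn (contMDiffOn_extChartAt_symm x)

theorem fderiv_localRep [IsManifold (𝓡 m) ∞ M] {φ : M → EuclideanSpace ℝ (Fin n)}
    (hφ : ContMDiff (𝓡 m) (𝓡 n) ∞ φ) (x : M) {z : EuclideanSpace ℝ (Fin m)}
    (hz : z ∈ (extChartAt (𝓡 m) x).target) (a : EuclideanSpace ℝ (Fin m)) :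
    fderiv ℝ (localRep φ x) z a = mfderiv (𝓡 m) (𝓡 n) φ ((extChartAt (𝓡 m) x).symm z)
      (mfderiv 𝓘(ℝ, EuclideanSpace ℝ (Fin m)) (𝓡 m) (extChartAt (𝓡 m) x).symm z a) := by
  have h1 : MDifferentiableAt 𝓘(ℝ, EuclideanSpace ℝ (Fin m)) (𝓡 m)
      (extChartAt (𝓡 m) x).symm z := by
    have : IsManifold (𝓡 m) 1 M := IsManifold.of_le (n := ∞) (by simp)
    simpa [mdifferentiableWithinAt_univ] using
      mdifferentiableWithinAt_extChartAt_symm (I := 𝓡 m) hz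
  have h2 := mfderiv_comp z ((hφ.mdifferentiable (by simp)) _) h1
  rw [← mfderiv_eq_fderiv]
  exact congrArg (fun A ↦ A a) h2

theorem mfderiv_eq_fderiv_localRep {φ : M → EuclideanSpace ℝ (Fin n)} {x : M}
    (hφ : MDifferentiableAt (𝓡 m) (𝓡 n) φ x) :
    mfderiv (𝓡 m) (𝓡 n) φ x = fderiv ℝ (localRep φ x) (extChartAt (𝓡 m) x x) := by
  rw [hφ.mfderiv]
  simp [localRep, writtenInExtChartAt]
  rfl


variable [RiemannianBundle (fun x : M ↦ TangentSpace (𝓡 m) x)]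

theorem IsIsometricImmersion.inner_eq {φ : M → EuclideanSpace ℝ (Fin n)}
    (hφ : IsIsometricImmersion m φ) (x : M) (a b : TangentSpace (𝓡 m) x) :
    ⟪a, b⟫ = ⟪fderiv ℝ (localRep φ x) (extChartAt (𝓡 m) x x) a,
      fderiv ℝ (localRep φ x) (extChartAt (𝓡 m) x x) b⟫ := by
  rw [← hφ.inner_mfderiv x a b,
    mfderiv_eq_fderiv_localRep (hφ.contMDiff.mdifferentiable (by simp) x)]
  rfl

variable [IsManifold (𝓡 m) ∞ M] {φ : M → EuclideanSpace ℝ (Fin n)}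

theorem IsIsometricImmersion.chartMetric_apply (hφ : IsIsometricImmersion m φ) (x : M)
    {z : EuclideanSpace ℝ (Fin m)} (hz : z ∈ (extChartAt (𝓡 m) x).target)
    (a b : EuclideanSpace ℝ (Fin m)) :
    chartMetric x z a b = ⟪fderiv ℝ (localRep φ x) z a, fderiv ℝ (localRep φ x) z b⟫ := by
  rw [fderiv_localRep hφ.contMDiff x hz, fderiv_localRep hφ.contMDiff x hz]
  exact (hφ.inner_mfderiv _ _ _).symm

theorem IsIsometricImmersion.injective_fderiv (hφ : IsIsometricImmersion m φ) (x : M)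
    {z : EuclideanSpace ℝ (Fin m)} (hz : z ∈ (extChartAt (𝓡 m) x).target) :
    Function.Injective (fderiv ℝ (localRep φ x) z) := by
  have : IsManifold (𝓡 m) 1 M := IsManifold.of_le (n := ∞) (by simp)
  have hinv := isInvertible_mfderivWithin_extChartAt_symm (I := 𝓡 m) hz
  rw [injective_iff_map_eq_zero]
  intro a ha
  have h1 : mfderiv 𝓘(ℝ, EuclideanSpace ℝ (Fin m)) (𝓡 m) (extChartAt (𝓡 m) x).symm z a = 0 := by
    have h2 : ⟪mfderiv 𝓘(ℝ, EuclideanSpace ℝ (Fin m)) (𝓡 m) (extChartAt (𝓡 m) x).symm z a,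
        mfderiv 𝓘(ℝ, EuclideanSpace ℝ (Fin m)) (𝓡 m) (extChartAt (𝓡 m) x).symm z a⟫ = 0 := by
      rw [← hφ.inner_mfderiv, ← fderiv_localRep hφ.contMDiff x hz, ha]
      exact inner_zero_left _
    exact inner_self_eq_zero.1 h2
  simp only [ModelWithCorners.range_eq_univ, mfderivWithin_univ] at hinv
  exact hinv.injective (h1.trans (map_zero _).symm)

/-- Positive definiteness gives injectivity, and the dimensions agree. Since `inverse` is 0 on
non-invertible maps, `christoffel` has its intended meaning only thanks to this. -/
theorem IsIsometricImmersion.isInvertible_chartMetric (hφ : IsIsometricImmersion m φ) (x : M)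
    {z : EuclideanSpace ℝ (Fin m)} (hz : z ∈ (extChartAt (𝓡 m) x).target) :
    (chartMetric x z).IsInvertible := by
  have hinj : Function.Injective
      (chartMetric x z : EuclideanSpace ℝ (Fin m) →ₗ[ℝ] EuclideanSpace ℝ (Fin m) →L[ℝ] ℝ) := by
    rw [injective_iff_map_eq_zero]
    intro a ha
    have h1 : chartMetric x z a a = 0 := congrArg (fun l ↦ l a) ha
    rw [hφ.chartMetric_apply x hz, inner_self_eq_zero] at h1
    exact hφ.injective_fderiv x hz (h1.trans (map_zero _).symm)
  have hdim : Module.finrank ℝ (EuclideanSpace ℝ (Fin m))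
      = Module.finrank ℝ (EuclideanSpace ℝ (Fin m) →L[ℝ] ℝ) :=
    (InnerProductSpace.toDual ℝ (EuclideanSpace ℝ (Fin m))).toLinearEquiv.finrank_eq
  exact ⟨(LinearEquiv.ofInjectiveOfFinrankEq _ hinj hdim).toContinuousLinearEquiv, rfl⟩

theorem IsIsometricImmersion.contDiffOn_chartMetric (hφ : IsIsometricImmersion m φ) (x : M) :
    ContDiffOn ℝ ∞ (chartMetric x) (extChartAt (𝓡 m) x).target := by
  have hD := (contDiffOn_localRep hφ.contMDiff x).fderiv_of_isOpen (m := ∞)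
    (isOpen_extChartAt_target x) (by simp)
  refine contDiffOn_clm_apply.2 fun a ↦ contDiffOn_clm_apply.2 fun b ↦ ?_
  refine ContDiffOn.congr ?_ fun z hz ↦ hφ.chartMetric_apply x hz a b
  exact (hD.clm_apply contDiffOn_const).inner ℝ (hD.clm_apply contDiffOn_const)

theorem IsIsometricImmersion.fderiv_chartMetric (hφ : IsIsometricImmersion m φ) (x : M)
    {z : EuclideanSpace ℝ (Fin m)} (hz : z ∈ (extChartAt (𝓡 m) x).target)
    (a b c : EuclideanSpace ℝ (Fin m)) :
    fderiv ℝ (chartMetric x) z a b c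
      = ⟪fderiv ℝ (fderiv ℝ (localRep φ x)) z a b, fderiv ℝ (localRep φ x) z c⟫
        + ⟪fderiv ℝ (localRep φ x) z b, fderiv ℝ (fderiv ℝ (localRep φ x)) z a c⟫ := by
  have hs := isOpen_extChartAt_target (I := 𝓡 m) x
  have hd : DifferentiableAt ℝ (chartMetric x) z :=
    ((hφ.contDiffOn_chartMetric x).contDiffAt (hs.mem_nhds hz)).differentiableAt (by simp)
  rw [← fderiv_inner_fderiv
    (differentiableAt_fderiv_of_contDiffOn hs (contDiffOn_localRep hφ.contMDiff x) hz)]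
  have h1 : (fun y ↦ chartMetric x y b c) =ᶠ[nhds z]
      fun y ↦ ⟪fderiv ℝ (localRep φ x) y b, fderiv ℝ (localRep φ x) y c⟫ := by
    filter_upwards [hs.mem_nhds hz] with y hy using hφ.chartMetric_apply x hy b c
  rw [← h1.fderiv_eq, fderiv_clm_apply (hd.clm_apply (differentiableAt_const b))
    (differentiableAt_const c), fderiv_clm_apply hd (differentiableAt_const b)]
  simp

/-- The product rule gives six terms. By symmetry of the second derivative the four that pair with
the a- or b-derivative of φ cancel, and the other two coincide. -/
theorem IsIsometricImmersion.christoffelFirst_apply (hφ : IsIsometricImmersion m φ) (x : M)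
    {z : EuclideanSpace ℝ (Fin m)} (hz : z ∈ (extChartAt (𝓡 m) x).target)
    (a b c : EuclideanSpace ℝ (Fin m)) :
    christoffelFirst x z a b c
      = ⟪fderiv ℝ (fderiv ℝ (localRep φ x)) z a b, fderiv ℝ (localRep φ x) z c⟫ := by
  have hsymm := fderiv_fderiv_comm_of_contDiffOn (isOpen_extChartAt_target (I := 𝓡 m) x)
    (contDiffOn_localRep hφ.contMDiff x) hz
  simp only [christoffelFirst, smul_apply, add_apply, sub_apply,
    ContinuousLinearMap.flip_apply, hφ.fderiv_chartMetric x hz, smul_eq_mul]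
  rw [hsymm b a, hsymm c a, hsymm c b, real_inner_comm _ (fderiv ℝ (localRep φ x) z b),
    real_inner_comm _ (fderiv ℝ (localRep φ x) z a)]
  ring

/-- The defining property of the Christoffel symbols, for the metric induced by `φ`. -/
theorem IsIsometricImmersion.inner_christoffel (hφ : IsIsometricImmersion m φ) (x : M)
    {z : EuclideanSpace ℝ (Fin m)} (hz : z ∈ (extChartAt (𝓡 m) x).target)
    (a b c : EuclideanSpace ℝ (Fin m)) :
    ⟪fderiv ℝ (localRep φ x) z (christoffel x z a b), fderiv ℝ (localRep φ x) z c⟫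
      = ⟪fderiv ℝ (fderiv ℝ (localRep φ x)) z a b, fderiv ℝ (localRep φ x) z c⟫ := by
  rw [← hφ.chartMetric_apply x hz, ← hφ.christoffelFirst_apply x hz, christoffel,
    (hφ.isInvertible_chartMetric x hz).self_apply_inverse]

set_option synthInstance.maxHeartbeats 200000 in
theorem IsIsometricImmersion.differentiableAt_christoffel (hφ : IsIsometricImmersion m φ) (x : M)
    {z : EuclideanSpace ℝ (Fin m)} (hz : z ∈ (extChartAt (𝓡 m) x).target)
    (a b : EuclideanSpace ℝ (Fin m)) :
    DifferentiableAt ℝ (fun y ↦ christoffel x y a b) z := by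
  have hs := isOpen_extChartAt_target (I := 𝓡 m) x
  have hΦ := contDiffOn_localRep hφ.contMDiff x
  have hD := hΦ.fderiv_of_isOpen (m := ∞) hs (by simp)
  have hDD := hD.fderiv_of_isOpen (m := ∞) hs (by simp)
  have hd : DifferentiableAt ℝ (chartMetric x) z :=
    ((hφ.contDiffOn_chartMetric x).contDiffAt (hs.mem_nhds hz)).differentiableAt (by simp)
  have hf : ContDiffOn ℝ ∞ (fun y ↦ christoffelFirst x y a b) (extChartAt (𝓡 m) x).target := by
    refine contDiffOn_clm_apply.2 fun c ↦ ?_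
    refine ContDiffOn.congr ?_ fun z hz ↦ hφ.christoffelFirst_apply x hz a b c
    exact ((hDD.clm_apply contDiffOn_const).clm_apply contDiffOn_const).inner ℝ
      (hD.clm_apply contDiffOn_const)
  have hinv : DifferentiableAt ℝ (fun y ↦ (chartMetric x y).inverse) z :=
    differentiableAt_clm_inverse hd (hφ.isInvertible_chartMetric x hz)
  exact hinv.clm_apply
    ((hf.contDiffAt (hs.mem_nhds hz)).differentiableAt (by simp))

end Gauss

/-! ### Second fundamental form, Gauss equation, Hessian of a restriction -/

section SecondFundamentalForm

variable {m n : ℕ} {M : Type*} [TopologicalSpace M] [ChartedSpace (EuclideanSpace ℝ (Fin m)) M]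

/-- The tangent space of the immersed manifold at `φ x`, as a subspace of `ℝ^n`. -/
noncomputable def tangentImage (φ : M → EuclideanSpace ℝ (Fin n)) (x : M) :
    Submodule ℝ (EuclideanSpace ℝ (Fin n)) :=
  (fderiv ℝ (localRep (m := m) φ x) (extChartAt (𝓡 m) x x)).range

/-- The second fundamental form of an immersion: the normal part of its second derivative. -/
noncomputable def secondFundamentalForm (φ : M → EuclideanSpace ℝ (Fin n)) (x : M) :
    EuclideanSpace ℝ (Fin m) →L[ℝ] EuclideanSpace ℝ (Fin m) →L[ℝ] (tangentImage (m := m) φ x)ᗮ :=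
  (ContinuousLinearMap.compL ℝ (EuclideanSpace ℝ (Fin m)) (EuclideanSpace ℝ (Fin n))
    (tangentImage (m := m) φ x)ᗮ ((tangentImage (m := m) φ x)ᗮ.orthogonalProjectionOnto)).comp
    (fderiv ℝ (fderiv ℝ (localRep φ x)) (extChartAt (𝓡 m) x x))

theorem secondFundamentalForm_apply (φ : M → EuclideanSpace ℝ (Fin n)) (x : M)
    (a b : EuclideanSpace ℝ (Fin m)) :
    secondFundamentalForm φ x a b = (tangentImage (m := m) φ x)ᗮ.orthogonalProjectionOnto
      (fderiv ℝ (fderiv ℝ (localRep φ x)) (extChartAt (𝓡 m) x x) a b) :=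
  rfl

theorem norm_secondFundamentalForm_le (φ : M → EuclideanSpace ℝ (Fin n)) (x : M)
    (a b : EuclideanSpace ℝ (Fin m)) :
    ‖secondFundamentalForm φ x a b‖
      ≤ ‖fderiv ℝ (fderiv ℝ (localRep φ x)) (extChartAt (𝓡 m) x x) a b‖ := by
  rw [secondFundamentalForm_apply]
  exact Submodule.norm_orthogonalProjectionOnto_apply_le _ _

variable [RiemannianBundle (fun x : M ↦ TangentSpace (𝓡 m) x)] [IsManifold (𝓡 m) ∞ M]
  {φ : M → EuclideanSpace ℝ (Fin n)}

theorem IsIsometricImmersion.secondFundamentalForm_comm (hφ : IsIsometricImmersion m φ) (x : M)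
    (a b : EuclideanSpace ℝ (Fin m)) :
    secondFundamentalForm φ x a b = secondFundamentalForm φ x b a := by
  rw [secondFundamentalForm_apply, secondFundamentalForm_apply,
    fderiv_fderiv_comm_of_contDiffOn (isOpen_extChartAt_target x)
      (contDiffOn_localRep hφ.contMDiff x) (mem_extChartAt_target x)]

theorem IsIsometricImmersion.finrank_orthogonal_tangentImage (hφ : IsIsometricImmersion m φ)
    (x : M) : m + Module.finrank ℝ (tangentImage (m := m) φ x)ᗮ = n := by
  have h1 := (tangentImage (m := m) φ x).finrank_add_finrank_orthogonal
  have h2 : Module.finrank ℝ (tangentImage (m := m) φ x) = m := by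
    rw [tangentImage, LinearMap.finrank_range_of_inj
      (hφ.injective_fderiv x (mem_extChartAt_target x))]
    simp
  rw [h2] at h1
  simpa using h1

/-- The Gauss formula. -/
theorem IsIsometricImmersion.coe_secondFundamentalForm (hφ : IsIsometricImmersion m φ) (x : M)
    (a b : EuclideanSpace ℝ (Fin m)) :
    (secondFundamentalForm φ x a b : EuclideanSpace ℝ (Fin n))
      = fderiv ℝ (fderiv ℝ (localRep φ x)) (extChartAt (𝓡 m) x x) a b
        - fderiv ℝ (localRep φ x) (extChartAt (𝓡 m) x x)
          (christoffel x (extChartAt (𝓡 m) x x) a b) := by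
  rw [secondFundamentalForm_apply, ← Submodule.starProjection_apply]
  refine Submodule.eq_starProjection_of_mem_orthogonal ?_ ?_
  · rw [Submodule.mem_orthogonal']
    rintro _ ⟨c, rfl⟩
    rw [inner_sub_left, sub_eq_zero]
    exact (hφ.inner_christoffel x (mem_extChartAt_target x) a b c).symm
  · rw [sub_sub_cancel]
    exact Submodule.le_orthogonal_orthogonal _ ⟨_, rfl⟩

theorem IsIsometricImmersion.inner_secondFundamentalForm_fderiv (hφ : IsIsometricImmersion m φ)
    (x : M) (a b c : EuclideanSpace ℝ (Fin m)) :
    ⟪(secondFundamentalForm φ x a b : EuclideanSpace ℝ (Fin n)),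
      fderiv ℝ (localRep φ x) (extChartAt (𝓡 m) x x) c⟫ = 0 := by
  rw [hφ.coe_secondFundamentalForm, inner_sub_left, sub_eq_zero]
  exact (hφ.inner_christoffel x (mem_extChartAt_target x) a b c).symm

-- Obtained by differentiating `inner_christoffel` in the direction a. This is half of the curvature
-- tensor; its third-derivative term is symmetric in a and b.
set_option synthInstance.maxHeartbeats 200000 in
theorem IsIsometricImmersion.inner_fderiv_christoffel (hφ : IsIsometricImmersion m φ)
    (x : M) (a b c d : EuclideanSpace ℝ (Fin m)) :
    ⟪fderiv ℝ (localRep φ x) (extChartAt (𝓡 m) x x)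
        (fderiv ℝ (fun z ↦ christoffel x z b c) (extChartAt (𝓡 m) x x) a
          + christoffel x (extChartAt (𝓡 m) x x) a (christoffel x (extChartAt (𝓡 m) x x) b c)),
      fderiv ℝ (localRep φ x) (extChartAt (𝓡 m) x x) d⟫
    = ⟪fderiv ℝ (fderiv ℝ (fderiv ℝ (localRep φ x))) (extChartAt (𝓡 m) x x) a b c,
        fderiv ℝ (localRep φ x) (extChartAt (𝓡 m) x x) d⟫
      + ⟪secondFundamentalForm φ x b c, secondFundamentalForm φ x a d⟫ := by
  have hs := isOpen_extChartAt_target (I := 𝓡 m) x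
  have hy := mem_extChartAt_target (I := 𝓡 m) x
  have hΦ := contDiffOn_localRep hφ.contMDiff x
  set y := extChartAt (𝓡 m) x x with hydef
  set Φ := localRep (m := m) φ x with hΦdef
  have hD := differentiableAt_fderiv_of_contDiffOn hs hΦ hy
  have hDD := differentiableAt_fderiv_fderiv_of_contDiffOn hs hΦ hy
  have hΓ := hφ.differentiableAt_christoffel x hy b c
  have heq : (fun z ↦ ⟪fderiv ℝ Φ z (christoffel x z b c), fderiv ℝ Φ z d⟫) =ᶠ[nhds y]
      fun z ↦ ⟪fderiv ℝ (fderiv ℝ Φ) z b c, fderiv ℝ Φ z d⟫ := by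
    filter_upwards [hs.mem_nhds hy] with z hz using hφ.inner_christoffel x hz b c d
  have hd : DifferentiableAt ℝ (fun z ↦ fderiv ℝ Φ z d) y :=
    hD.clm_apply (differentiableAt_const d)
  have hDDb : DifferentiableAt ℝ (fun z ↦ fderiv ℝ (fderiv ℝ Φ) z b) y :=
    hDD.clm_apply (differentiableAt_const b)
  have h1 := DFunLike.congr_fun (heq.fderiv_eq (𝕜 := ℝ)) a
  rw [fderiv_inner_apply ℝ (hD.clm_apply hΓ) hd,
    fderiv_inner_apply ℝ (hDDb.clm_apply (differentiableAt_const c)) hd,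
    fderiv_fderiv_apply hD, fderiv_clm_apply hD hΓ,
    fderiv_clm_apply hDDb (differentiableAt_const c),
    fderiv_clm_apply hDD (differentiableAt_const b)] at h1
  simp only [add_apply, ContinuousLinearMap.comp_apply, ContinuousLinearMap.flip_apply,
    fderiv_fun_const, Pi.zero_apply, zero_apply, map_zero, zero_add, inner_add_left] at h1
  have h2 := hφ.inner_christoffel x hy a (christoffel x y b c) d
  -- The second fundamental form at (b, c) is normal, so it sees only the normal part of the second
  -- derivative at (a, d).
  have h3 : ⟪secondFundamentalForm φ x b c, secondFundamentalForm φ x a d⟫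
      = ⟪fderiv ℝ (fderiv ℝ Φ) y b c, fderiv ℝ (fderiv ℝ Φ) y a d⟫
        - ⟪fderiv ℝ Φ y (christoffel x y b c), fderiv ℝ (fderiv ℝ Φ) y a d⟫ := by
    rw [Submodule.coe_inner, hφ.coe_secondFundamentalForm x a d, inner_sub_right,
      hφ.inner_secondFundamentalForm_fderiv, sub_zero, hφ.coe_secondFundamentalForm x b c,
      inner_sub_left]
  rw [map_add, inner_add_left, h2, h3]
  linarith

/-- Antisymmetrising `inner_fderiv_christoffel` in a and b cancels the third derivatives of the
immersion. -/
theorem IsIsometricImmersion.inner_fderiv_chartCurvature (hφ : IsIsometricImmersion m φ)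
    (x : M) (a b c d : EuclideanSpace ℝ (Fin m)) :
    ⟪fderiv ℝ (localRep φ x) (extChartAt (𝓡 m) x x)
        (chartCurvature x (extChartAt (𝓡 m) x x) a b c),
      fderiv ℝ (localRep φ x) (extChartAt (𝓡 m) x x) d⟫
      = ⟪secondFundamentalForm φ x b c, secondFundamentalForm φ x a d⟫
        - ⟪secondFundamentalForm φ x a c, secondFundamentalForm φ x b d⟫ := by
  have h1 := hφ.inner_fderiv_christoffel x a b c d
  have h2 := hφ.inner_fderiv_christoffel x b a c d
  have hD := (contDiffOn_localRep hφ.contMDiff x).fderiv_of_isOpen (m := ∞)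
    (isOpen_extChartAt_target x) (by simp)
  rw [fderiv_fderiv_comm_of_contDiffOn (isOpen_extChartAt_target x) hD
    (mem_extChartAt_target x) b a] at h2
  have h3 : chartCurvature x (extChartAt (𝓡 m) x x) a b c
      = (fderiv ℝ (fun z ↦ christoffel x z b c) (extChartAt (𝓡 m) x x) a
          + christoffel x (extChartAt (𝓡 m) x x) a (christoffel x (extChartAt (𝓡 m) x x) b c))
        - (fderiv ℝ (fun z ↦ christoffel x z a c) (extChartAt (𝓡 m) x x) b
          + christoffel x (extChartAt (𝓡 m) x x) b
            (christoffel x (extChartAt (𝓡 m) x x) a c)) := by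
    unfold chartCurvature
    abel
  rw [h3, map_sub, inner_sub_left, h1, h2]
  ring

/-- The **Gauss equation**. -/
theorem IsIsometricImmersion.inner_riemannCurvature (hφ : IsIsometricImmersion m φ)
    (x : M) (a b c d : TangentSpace (𝓡 m) x) :
    ⟪riemannCurvature x a b c, d⟫
      = ⟪secondFundamentalForm φ x b c, secondFundamentalForm φ x a d⟫
        - ⟪secondFundamentalForm φ x a c, secondFundamentalForm φ x b d⟫ :=
  (hφ.inner_eq x _ _).trans (hφ.inner_fderiv_chartCurvature x a b c d)

/-- The Hessian of the restriction to an immersed manifold of a function on `ℝ^n`. -/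
theorem IsIsometricImmersion.hessian_comp (hφ : IsIsometricImmersion m φ)
    {f : EuclideanSpace ℝ (Fin n) → ℝ} (hf : ContDiff ℝ 2 f) (x : M)
    (a b : EuclideanSpace ℝ (Fin m)) :
    hessian (f ∘ φ) x a b
      = fderiv ℝ (fderiv ℝ f) (φ x) (fderiv ℝ (localRep φ x) (extChartAt (𝓡 m) x x) a)
          (fderiv ℝ (localRep φ x) (extChartAt (𝓡 m) x x) b)
        + fderiv ℝ f (φ x) (secondFundamentalForm φ x a b) := by
  have hs := isOpen_extChartAt_target (I := 𝓡 m) x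
  have hy := mem_extChartAt_target (I := 𝓡 m) x
  have hΦ := contDiffOn_localRep hφ.contMDiff x
  have hΦy : localRep φ x (extChartAt (𝓡 m) x x) = φ x := by simp [localRep]
  have hw := fderiv_comp (extChartAt (𝓡 m) x x) (hf.differentiable (by simp) _)
    ((hΦ.contDiffAt (hs.mem_nhds hy)).differentiableAt (by simp))
  have hh : hessian (f ∘ φ) x a b
      = fderiv ℝ (fderiv ℝ (f ∘ localRep φ x)) (extChartAt (𝓡 m) x x) a b
        - fderiv ℝ (f ∘ localRep φ x) (extChartAt (𝓡 m) x x)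
          (christoffel x (extChartAt (𝓡 m) x x) a b) := rfl
  rw [hh, fderiv_fderiv_comp hf hs hΦ hy, hw, hΦy, hφ.coe_secondFundamentalForm, map_sub,
    ContinuousLinearMap.comp_apply]
  ring

end SecondFundamentalForm

/-! ### From bounds on the second fundamental form and the Hessian to curvature -/

section Curvature

variable {m n : ℕ} {M : Type*} [TopologicalSpace M] [ChartedSpace (EuclideanSpace ℝ (Fin m)) M]
  [RiemannianBundle (fun x : M ↦ TangentSpace (𝓡 m) x)] [IsManifold (𝓡 m) ∞ M]
  {φ : M → EuclideanSpace ℝ (Fin n)}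

/-- The sectional curvature in terms of the second fundamental form. -/
theorem IsIsometricImmersion.sectionalCurvature_eq (hφ : IsIsometricImmersion m φ) (x : M)
    (a b : TangentSpace (𝓡 m) x) :
    sectionalCurvature x a b
      = (⟪secondFundamentalForm φ x b b, secondFundamentalForm φ x a a⟫
          - ⟪secondFundamentalForm φ x a b, secondFundamentalForm φ x b a⟫)
        / (⟪fderiv ℝ (localRep φ x) (extChartAt (𝓡 m) x x) a,
              fderiv ℝ (localRep φ x) (extChartAt (𝓡 m) x x) a⟫
            * ⟪fderiv ℝ (localRep φ x) (extChartAt (𝓡 m) x x) b,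
              fderiv ℝ (localRep φ x) (extChartAt (𝓡 m) x x) b⟫
          - ⟪fderiv ℝ (localRep φ x) (extChartAt (𝓡 m) x x) a,
              fderiv ℝ (localRep φ x) (extChartAt (𝓡 m) x x) b⟫ ^ 2) := by
  unfold sectionalCurvature
  rw [hφ.inner_riemannCurvature, hφ.inner_eq, hφ.inner_eq, hφ.inner_eq]

/-- A lower bound on the diagonal of the second fundamental form, in codimension less than the
dimension, bounds the sectional curvature from below. -/
theorem IsIsometricImmersion.le_of_secondFundamentalForm_lower_bound
    (hφ : IsIsometricImmersion m φ) (hcod : n < 2 * m) {χ : ℝ} (hχ : 0 ≤ χ)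
    (hsec : SectionalCurvatureLE m M (χ ^ 2)) (x : M) {c : ℝ}
    (hlow : ∀ w : EuclideanSpace ℝ (Fin m),
      c * ‖fderiv ℝ (localRep φ x) (extChartAt (𝓡 m) x x) w‖ ^ 2
        ≤ ‖secondFundamentalForm φ x w w‖) : c ≤ χ := by
  rcases le_or_gt c 0 with hc | hc
  · exact hc.trans hχ
  have hinj := hφ.injective_fderiv x (mem_extChartAt_target x)
  have hdim : Module.finrank ℝ (tangentImage (m := m) φ x)ᗮ
      < Module.finrank ℝ (EuclideanSpace ℝ (Fin m)) := by
    have := hφ.finrank_orthogonal_tangentImage x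
    rw [finrank_euclideanSpace_fin]
    omega
  obtain ⟨a, b, ha, hb, horth, hab, hle⟩ :=
    exists_orthogonal_of_bilinear_diag_lower_bound hdim _ hinj (secondFundamentalForm φ x)
      (hφ.secondFundamentalForm_comm x) hc hlow
  have hpos : ∀ w : EuclideanSpace ℝ (Fin m), w ≠ 0 →
      0 < ‖fderiv ℝ (localRep φ x) (extChartAt (𝓡 m) x x) w‖ := fun w hw ↦
    norm_pos_iff.2 fun h ↦ hw (hinj (h.trans (map_zero _).symm))
  have hli : LinearIndependent ℝ ![a, b] := by
    have h1 : LinearIndependent ℝ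
        ![fderiv ℝ (localRep φ x) (extChartAt (𝓡 m) x x) a,
          fderiv ℝ (localRep φ x) (extChartAt (𝓡 m) x x) b] := by
      refine linearIndependent_of_ne_zero_of_inner_eq_zero (𝕜 := ℝ) ?_ ?_
      · intro i
        fin_cases i
        · exact norm_pos_iff.1 (hpos a ha)
        · exact norm_pos_iff.1 (hpos b hb)
      · intro i j hij
        fin_cases i <;> fin_cases j
        · exact absurd rfl hij
        · exact horth
        · exact (real_inner_comm _ _).trans horth
        · exact absurd rfl hij
    refine LinearIndependent.of_comp
      (fderiv ℝ (localRep φ x) (extChartAt (𝓡 m) x x)).toLinearMap ?_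
    convert! h1 using 1
    ext i
    fin_cases i <;> rfl
  have h2 := hsec x a b hli
  have h3 : sectionalCurvature x (a : TangentSpace (𝓡 m) x) (b : TangentSpace (𝓡 m) x)
      = ⟪secondFundamentalForm φ x a a, secondFundamentalForm φ x b b⟫
        / (‖fderiv ℝ (localRep φ x) (extChartAt (𝓡 m) x x) a‖ ^ 2
          * ‖fderiv ℝ (localRep φ x) (extChartAt (𝓡 m) x x) b‖ ^ 2) := by
    refine (hφ.sectionalCurvature_eq x a b).trans ?_
    rw [horth, hab, real_inner_self_eq_norm_sq, real_inner_self_eq_norm_sq, inner_zero_left,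
      real_inner_comm]
    simp
  rw [h3] at h2
  have h4 : c ^ 2 ≤ χ ^ 2 := by
    refine le_trans ?_ h2
    have := hpos a ha
    have := hpos b hb
    rwa [le_div_iff₀ (by positivity)]
  exact abs_le_of_sq_le_sq' h4 hχ |>.2

set_option synthInstance.maxHeartbeats 200000 in
/-- If the supremum of the Hessian on unit vectors is less than `ε`, then the Hessian is at most
`ε` times the metric. -/
theorem IsIsometricImmersion.hessian_le_of_iSup_lt (hφ : IsIsometricImmersion m φ)
    {f : EuclideanSpace ℝ (Fin n) → ℝ} (hf : ContDiff ℝ 2 f) (x : M) {ε : ℝ}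
    (h : (⨆ v : {v : TangentSpace (𝓡 m) x // ‖v‖ = 1}, hessian (f ∘ φ) x v.1 v.1) < ε)
    (w : EuclideanSpace ℝ (Fin m)) :
    hessian (f ∘ φ) x w w
      ≤ ε * ‖fderiv ℝ (localRep φ x) (extChartAt (𝓡 m) x x) w‖ ^ 2 := by
  have hinj := hφ.injective_fderiv x (mem_extChartAt_target x)
  set D := fderiv ℝ (localRep φ x) (extChartAt (𝓡 m) x x) with hD
  have hnorm : ∀ v : TangentSpace (𝓡 m) x, ‖v‖ = ‖D v‖ := fun v ↦ by
    rw [← sq_eq_sq₀ (norm_nonneg _) (norm_nonneg _), ← real_inner_self_eq_norm_sq,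
      ← real_inner_self_eq_norm_sq, hφ.inner_eq]
  -- Injectivity of D bounds the model-space norm of vectors of metric length 1.
  obtain ⟨K, -, hK⟩ := (D : EuclideanSpace ℝ (Fin m) →ₗ[ℝ]
    EuclideanSpace ℝ (Fin n)).exists_antilipschitzWith (LinearMap.ker_eq_bot.2 hinj)
  -- A real supremum over an unbounded family is 0 by convention, so `h` controls individual values
  -- only once boundedness is known.
  have hbdd : BddAbove (Set.range
      fun v : {v : TangentSpace (𝓡 m) x // ‖v‖ = 1} ↦ hessian (f ∘ φ) x v.1 v.1) := by
    refine ⟨‖fderiv ℝ (fderiv ℝ f) (φ x)‖ + ‖fderiv ℝ f (φ x)‖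
      * (‖fderiv ℝ (fderiv ℝ (localRep φ x)) (extChartAt (𝓡 m) x x)‖ * K * K), ?_⟩
    have hC : ∀ v : EuclideanSpace ℝ (Fin m), ‖D v‖ = 1 → hessian (f ∘ φ) x v v
        ≤ ‖fderiv ℝ (fderiv ℝ f) (φ x)‖ + ‖fderiv ℝ f (φ x)‖
          * (‖fderiv ℝ (fderiv ℝ (localRep φ x)) (extChartAt (𝓡 m) x x)‖ * K * K) := by
      intro v hv
      have hvK : ‖v‖ ≤ K := by
        have h1 : ‖(D : EuclideanSpace ℝ (Fin m) →ₗ[ℝ] EuclideanSpace ℝ (Fin n)) v‖ = 1 := hv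
        have h2 := ZeroHomClass.bound_of_antilipschitz _ hK v
        rwa [h1, mul_one] at h2
      rw [hφ.hessian_comp hf]
      refine add_le_add ?_ ?_
      · refine (Real.le_norm_self _).trans ((ContinuousLinearMap.le_opNorm₂ _ _ _).trans ?_)
        rw [← hD, hv, mul_one, mul_one]
      · refine (Real.le_norm_self _).trans ((ContinuousLinearMap.le_opNorm _ _).trans ?_)
        refine mul_le_mul_of_nonneg_left ?_ (norm_nonneg _)
        refine (norm_secondFundamentalForm_le φ x v v).trans
          ((ContinuousLinearMap.le_opNorm₂ _ _ _).trans ?_)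
        gcongr
    rintro _ ⟨⟨v, hv⟩, rfl⟩
    exact hC v ((hnorm v).symm.trans hv)
  rcases eq_or_ne w 0 with rfl | hw
  · rw [hφ.hessian_comp hf, map_zero, map_zero, map_zero, ZeroMemClass.coe_zero,
      map_zero]
    simp
  have hw0 : ‖D w‖ ≠ 0 := norm_ne_zero_iff.2 fun h ↦ hw (hinj (h.trans (map_zero _).symm))
  have hu : ‖(show TangentSpace (𝓡 m) x from ‖D w‖⁻¹ • w)‖ = 1 := by
    rw [hnorm]
    change ‖D (‖D w‖⁻¹ • w)‖ = 1
    rw [map_smul, norm_smul, norm_inv, norm_norm, inv_mul_cancel₀ hw0]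
  have h1 := (le_ciSup hbdd ⟨_, hu⟩).trans h.le
  have h2 : hessian (f ∘ φ) x (‖D w‖⁻¹ • w : EuclideanSpace ℝ (Fin m))
      (‖D w‖⁻¹ • w : EuclideanSpace ℝ (Fin m))
      = (‖D w‖ ^ 2)⁻¹ * hessian (f ∘ φ) x w w := by
    rw [hφ.hessian_comp hf, hφ.hessian_comp hf]
    simp only [map_smul, smul_apply, Submodule.coe_smul, smul_eq_mul]
    field_simp
  have h3 : (‖D w‖ ^ 2)⁻¹ * hessian (f ∘ φ) x w w ≤ ε := h2.symm.trans_le h1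
  rwa [inv_mul_le_iff₀ (by positivity), mul_comm] at h3

end Curvature

/-! ### The comparison function on the cone -/

section ConeFunction

variable {F : Type*} [NormedAddCommGroup F]

/-- The function `z ↦ √(T² + a² |z - o|²)`. -/
noncomputable def hyperboloid (T a : ℝ) (o z : F) : ℝ := √(T ^ 2 + a ^ 2 * ‖z - o‖ ^ 2)

variable {T : ℝ}

theorem hyperboloid_pos (hT : 0 < T) (a : ℝ) (o z : F) : 0 < hyperboloid T a o z :=
  Real.sqrt_pos.2 (by positivity)

theorem hyperboloid_sq (hT : 0 < T) (a : ℝ) (o z : F) :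
    hyperboloid T a o z ^ 2 = T ^ 2 + a ^ 2 * ‖z - o‖ ^ 2 :=
  Real.sq_sqrt (by positivity)

variable [InnerProductSpace ℝ F]

/-- The function `z ↦ √(T² + a² |z - o|²) - ⟪z - o, v⟫`. -/
noncomputable def coneFunction (T a : ℝ) (o v z : F) : ℝ := hyperboloid T a o z - ⟪v, z - o⟫

theorem contDiff_coneFunction (hT : 0 < T) (a : ℝ) (o v : F) :
    ContDiff ℝ ∞ (coneFunction T a o v) := by
  unfold coneFunction hyperboloid
  refine ContDiff.sub (ContDiff.sqrt ?_ fun z ↦ by positivity) ?_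
  · exact contDiff_const.add (contDiff_const.mul ((contDiff_id.sub contDiff_const).norm_sq ℝ))
  · exact contDiff_const.inner ℝ (contDiff_id.sub contDiff_const)

theorem hasFDerivAt_hyperboloid (hT : 0 < T) (a : ℝ) (o z : F) :
    HasFDerivAt (hyperboloid T a o)
      ((a ^ 2 / hyperboloid T a o z) • innerSL ℝ (z - o)) z := by
  have h1 : HasFDerivAt (fun y : F ↦ T ^ 2 + a ^ 2 * ‖y - o‖ ^ 2)
      (a ^ 2 • (2 • (innerSL ℝ (z - o)).comp (ContinuousLinearMap.id ℝ F))) z :=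
    (((hasFDerivAt_id z).sub_const o).norm_sq.const_mul (a ^ 2)).const_add (T ^ 2)
  have h2 := h1.sqrt (by positivity)
  refine h2.congr_fderiv ?_
  ext u
  have := (hyperboloid_pos hT a o z).ne'
  rw [hyperboloid] at this ⊢
  simp
  field_simp

theorem fderiv_coneFunction_apply (hT : 0 < T) (a : ℝ) (o v z w : F) :
    fderiv ℝ (coneFunction T a o v) z w
      = a ^ 2 * ⟪z - o, w⟫ / hyperboloid T a o z - ⟪v, w⟫ := by
  have h1 : HasFDerivAt (fun y : F ↦ ⟪v, y - o⟫) (innerSL ℝ v) z :=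
    (innerSL ℝ v).hasFDerivAt.comp z ((hasFDerivAt_id z).sub_const o)
  have h2 := (hasFDerivAt_hyperboloid hT a o z).sub h1
  have h3 : fderiv ℝ (coneFunction T a o v) z = _ := h2.fderiv
  rw [h3]
  simp only [sub_apply, smul_apply, innerSL_apply_apply, smul_eq_mul]
  ring

theorem fderiv_fderiv_coneFunction_apply (hT : 0 < T) (a : ℝ) (o v z w : F) :
    fderiv ℝ (fderiv ℝ (coneFunction T a o v)) z w w
      = a ^ 2 * ‖w‖ ^ 2 / hyperboloid T a o z
        - a ^ 4 * ⟪z - o, w⟫ ^ 2 / hyperboloid T a o z ^ 3 := by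
  have hd : DifferentiableAt ℝ (fderiv ℝ (coneFunction T a o v)) z :=
    (((contDiff_coneFunction hT a o v).fderiv_right (m := ∞) (by simp)).differentiable
      (by simp)) z
  rw [← fderiv_fderiv_apply hd]
  have h0 : (fun y ↦ fderiv ℝ (coneFunction T a o v) y w)
      = fun y ↦ (a ^ 2 * ⟪w, y - o⟫) * (hyperboloid T a o y)⁻¹ - ⟪v, w⟫ := by
    funext y
    rw [fderiv_coneFunction_apply hT, real_inner_comm, div_eq_mul_inv]
  have h1 : HasFDerivAt (fun y : F ↦ a ^ 2 * ⟪w, y - o⟫) (a ^ 2 • innerSL ℝ w) z :=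
    ((innerSL ℝ w).hasFDerivAt.comp z ((hasFDerivAt_id z).sub_const o)).const_mul (a ^ 2)
  have hp := (hyperboloid_pos hT a o z).ne'
  have h2 := (hasDerivAt_inv hp).comp_hasFDerivAt z (hasFDerivAt_hyperboloid hT a o z)
  have h3 := (h1.mul h2).sub_const ⟪v, w⟫
  have h4 : fderiv ℝ (fun y ↦ (a ^ 2 * ⟪w, y - o⟫) * (hyperboloid T a o y)⁻¹ - ⟪v, w⟫) z = _ :=
    h3.fderiv
  rw [h0, h4]
  simp only [add_apply, smul_apply, innerSL_apply_apply, smul_eq_mul, Function.comp_apply,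
    real_inner_self_eq_norm_sq, real_inner_comm w (z - o)]
  field_simp
  ring

/-- By Cauchy–Schwarz the worst direction w is radial, and there a²/s - a⁴|z - o|²/s³ = a²T²/s³. -/
theorem fderiv_fderiv_coneFunction_ge (hT : 0 < T) (a : ℝ) (o v z w : F) :
    a ^ 2 * T ^ 2 / hyperboloid T a o z ^ 3 * ‖w‖ ^ 2
      ≤ fderiv ℝ (fderiv ℝ (coneFunction T a o v)) z w w := by
  rw [fderiv_fderiv_coneFunction_apply hT]
  have hp := hyperboloid_pos hT a o z
  have hsq := hyperboloid_sq hT a o z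
  set s := hyperboloid T a o z
  have h1 : ⟪z - o, w⟫ ^ 2 ≤ ‖z - o‖ ^ 2 * ‖w‖ ^ 2 := by
    rw [← mul_pow, ← sq_abs]
    exact pow_le_pow_left₀ (abs_nonneg _) (abs_real_inner_le_norm _ _) 2
  have h2 : a ^ 2 * ‖w‖ ^ 2 / s - a ^ 4 * ⟪z - o, w⟫ ^ 2 / s ^ 3
      - a ^ 2 * T ^ 2 / s ^ 3 * ‖w‖ ^ 2
      = a ^ 4 * (‖z - o‖ ^ 2 * ‖w‖ ^ 2 - ⟪z - o, w⟫ ^ 2) / s ^ 3 := by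
    field_simp
    rw [hsq]
    ring
  have h3 : 0 ≤ a ^ 4 * (‖z - o‖ ^ 2 * ‖w‖ ^ 2 - ⟪z - o, w⟫ ^ 2) / s ^ 3 :=
    div_nonneg (mul_nonneg (by positivity) (sub_nonneg.2 h1)) (by positivity)
  linarith

/-- The gradient is λ(z - o) - v with λ = a²/s. Since a|z - o| is at most both s and ⟪v, z - o⟫, one
has λ|z - o|² ≤ ⟪v, z - o⟫, so its squared norm 1 - 2λ⟪v, z - o⟫ + λ²|z - o|² is at most 1. -/
theorem abs_fderiv_coneFunction_le (hT : 0 < T) (a : ℝ) (o v z w : F) (hv : ‖v‖ = 1) (ha : 0 ≤ a)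
    (hz : a * ‖z - o‖ ≤ ⟪v, z - o⟫) :
    |fderiv ℝ (coneFunction T a o v) z w| ≤ ‖w‖ := by
  have hp := hyperboloid_pos hT a o z
  have hsq := hyperboloid_sq hT a o z
  have h0 : fderiv ℝ (coneFunction T a o v) z w
      = ⟪(a ^ 2 / hyperboloid T a o z) • (z - o) - v, w⟫ := by
    rw [fderiv_coneFunction_apply hT, inner_sub_left _ v, real_inner_smul_left]
    ring
  rw [h0]
  set s := hyperboloid T a o z
  have har : a * ‖z - o‖ ≤ s := by
    refine le_of_sq_le_sq ?_ hp.le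
    rw [hsq]
    nlinarith [sq_nonneg T]
  have h1 : ‖(a ^ 2 / s) • (z - o) - v‖ ^ 2 ≤ 1 := by
    rw [norm_sub_sq_real, real_inner_smul_left, norm_smul, mul_pow, Real.norm_eq_abs, sq_abs, hv,
      real_inner_comm]
    have h2 : a ^ 2 / s * ‖z - o‖ ^ 2 ≤ ⟪v, z - o⟫ := by
      rw [div_mul_eq_mul_div, div_le_iff₀ hp]
      calc a ^ 2 * ‖z - o‖ ^ 2 = (a * ‖z - o‖) * (a * ‖z - o‖) := by ring
        _ ≤ ⟪v, z - o⟫ * s := mul_le_mul hz har (by positivity) (le_trans (by positivity) hz)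
    have h3 : 0 ≤ ⟪v, z - o⟫ := le_trans (by positivity) hz
    have h4 : 0 ≤ a ^ 2 / s := by positivity
    nlinarith [mul_le_mul_of_nonneg_left h2 h4, mul_nonneg h4 h3]
  have h5 : ‖(a ^ 2 / s) • (z - o) - v‖ ≤ 1 := by
    nlinarith [norm_nonneg ((a ^ 2 / s) • (z - o) - v)]
  calc _ ≤ ‖(a ^ 2 / s) • (z - o) - v‖ * ‖w‖ := abs_real_inner_le_norm _ _
    _ ≤ 1 * ‖w‖ := by gcongr
    _ = ‖w‖ := one_mul _

/-- Makes the test function bounded above even if φ(M) is unbounded: the cone condition lets the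
height absorb the linear growth of the square root. -/
theorem coneFunction_le (hT : 0 < T) (a : ℝ) (o v z : F) (ha : 0 ≤ a)
    (hz : a * ‖z - o‖ ≤ ⟪v, z - o⟫) :
    coneFunction T a o v z ≤ T := by
  have h1 : hyperboloid T a o z ≤ T + a * ‖z - o‖ := by
    refine Real.sqrt_le_iff.2 ⟨by positivity, ?_⟩
    have : 0 ≤ T * (a * ‖z - o‖) := by positivity
    nlinarith
  unfold coneFunction
  linarith

theorem sub_inner_le_coneFunction (T a : ℝ) (o v z : F) :
    T - ⟪v, z - o⟫ ≤ coneFunction T a o v z := by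
  have h1 : T ≤ hyperboloid T a o z := Real.le_sqrt_of_sq_le (by
    nlinarith [mul_nonneg (sq_nonneg a) (sq_nonneg ‖z - o‖)])
  unfold coneFunction
  linarith

end ConeFunction

/-! ### The maximum principle estimate -/

section Estimate

variable {m n : ℕ} {M : Type*} [TopologicalSpace M] [ChartedSpace (EuclideanSpace ℝ (Fin m)) M]
  [RiemannianBundle (fun x : M ↦ TangentSpace (𝓡 m) x)] [IsManifold (𝓡 m) ∞ M]
  {φ : M → EuclideanSpace ℝ (Fin n)} {o v : EuclideanSpace ℝ (Fin n)} {θ : ℝ}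

theorem cos_mul_norm_le_of_mem_cone {z : EuclideanSpace ℝ (Fin n)} (hz : z ∈ cone o v θ) :
    Real.cos θ * ‖z - o‖ ≤ ⟪v, z - o⟫ := by
  obtain ⟨hzo, h⟩ := hz
  have hpos : 0 < ‖z - o‖ := norm_pos_iff.2 (sub_ne_zero.2 hzo)
  rw [real_inner_smul_left, le_inv_mul_iff₀ hpos, real_inner_comm] at h
  rwa [mul_comm]

/-- The weak maximum principle applied to the cone function: a point of `φ(M)` at height less than
`T` over the hyperplane forces the curvature of `M` to be large. -/
theorem IsIsometricImmersion.curvature_lower_bound (hφ : IsIsometricImmersion m φ)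
    (hcod : n < 2 * m) (hwmp : WeakMaximumPrincipleHessian m M) {χ : ℝ} (hχ : 0 ≤ χ)
    (hsec : SectionalCurvatureLE m M (χ ^ 2)) (hv : ‖v‖ = 1) (hθ : 0 < Real.cos θ)
    (hcone : Set.range φ ⊆ cone o v θ) {T : ℝ} (hT : 0 < T) {q : M} (hq : ⟪v, φ q - o⟫ < T)
    {α : ℝ} (hα0 : 0 < α) (hα1 : α < 1) :
    α ^ 2 * √(1 - α ^ 2) ^ 3 * Real.cos θ ^ 2 ≤ χ * T := by
  -- The factor α < 1 leaves the room 1 - α² that later bounds s in terms of T.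
  set a := α * Real.cos θ with ha
  set β := √(1 - α ^ 2) with hβ
  have hβ2 : β ^ 2 = 1 - α ^ 2 := Real.sq_sqrt (by nlinarith)
  have hβ0 : 0 ≤ β := Real.sqrt_nonneg _
  have ha0 : 0 ≤ a := by positivity
  have hcos : ∀ x, Real.cos θ * ‖φ x - o‖ ≤ ⟪v, φ x - o⟫ := fun x ↦
    cos_mul_norm_le_of_mem_cone (hcone ⟨x, rfl⟩)
  have hheight : ∀ x, a * ‖φ x - o‖ ≤ ⟪v, φ x - o⟫ := fun x ↦ by
    have h1 : 0 ≤ Real.cos θ * ‖φ x - o‖ := by positivity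
    have h2 := hcos x
    rw [ha, mul_assoc]
    nlinarith
  have hf := contDiff_coneFunction hT a o v
  have hf2 : ContDiff ℝ 2 (coneFunction T a o v) := hf.of_le ENat.LEInfty.out
  have hu : ContMDiff (𝓡 m) 𝓘(ℝ, ℝ) 2 (coneFunction T a o v ∘ φ) :=
    hf2.contMDiff.comp (hφ.contMDiff.of_le ENat.LEInfty.out)
  have hbdd : BddAbove (Set.range (coneFunction T a o v ∘ φ)) := by
    refine ⟨T, ?_⟩
    rintro _ ⟨x, rfl⟩
    exact coneFunction_le hT a o v (φ x) ha0 (hheight x)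
  obtain ⟨p, hp⟩ := hwmp _ hu hbdd
  have hsup : T - ⟪v, φ q - o⟫ ≤ ⨆ z, (coneFunction T a o v ∘ φ) z :=
    (sub_inner_le_coneFunction T a o v (φ q)).trans (le_ciSup hbdd q)
  have hlim : Filter.Tendsto (fun k : ℕ ↦ a ^ 2 * β ^ 3 / T - 1 / (k : ℝ)) Filter.atTop
      (nhds (a ^ 2 * β ^ 3 / T)) := by
    simpa using (tendsto_const_nhds (x := a ^ 2 * β ^ 3 / T)).sub
      (tendsto_one_div_atTop_nhds_zero_nat (𝕜 := ℝ))
  have hev : ∀ᶠ k : ℕ in Filter.atTop, 1 / (k : ℝ) < T - ⟪v, φ q - o⟫ :=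
    (tendsto_one_div_atTop_nhds_zero_nat (𝕜 := ℝ)).eventually_lt_const (sub_pos.2 hq)
  have hmain : a ^ 2 * β ^ 3 / T ≤ χ := by
    refine le_of_tendsto hlim ?_
    filter_upwards [hev, Filter.eventually_ge_atTop 1] with k hk hk1
    obtain ⟨hpk, hHess⟩ := hp k hk1
    refine hφ.le_of_secondFundamentalForm_lower_bound hcod hχ hsec (p k) fun w ↦ ?_
    have h1 := hφ.hessian_le_of_iSup_lt hf2 (p k) hHess w
    rw [hφ.hessian_comp hf2] at h1
    have hs0 := hyperboloid_pos hT a o (φ (p k))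
    have hs2 := hyperboloid_sq hT a o (φ (p k))
    have h2 := fderiv_fderiv_coneFunction_ge hT a o v (φ (p k))
      (fderiv ℝ (localRep φ (p k)) (extChartAt (𝓡 m) (p k) (p k)) w)
    have h3 := abs_le.1 (abs_fderiv_coneFunction_le hT a o v (φ (p k))
      (secondFundamentalForm φ (p k) w w) hv ha0 (hheight (p k)))
    -- The choice of k makes the test function positive at `p k`, since 1/k < T - ⟪v, φ q - o⟫ ≤ sup
    -- u.
    have h4 : ⟪v, φ (p k) - o⟫ ≤ hyperboloid T a o (φ (p k)) := by
      have h5 : 0 < hyperboloid T a o (φ (p k)) - ⟪v, φ (p k) - o⟫ :=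
        lt_trans (by linarith) hpk
      linarith
    -- From cos θ |z - o| ≤ ⟪v, z - o⟫ ≤ s follows a|z - o| ≤ αs; then s² = T² + a²|z - o|² ≤ T² +
    -- α²s², and the last term is absorbed on the left.
    have h5 : (β * hyperboloid T a o (φ (p k))) ^ 2 ≤ T ^ 2 := by
      have h6 : (Real.cos θ * ‖φ (p k) - o‖) ^ 2 ≤ hyperboloid T a o (φ (p k)) ^ 2 :=
        pow_le_pow_left₀ (by positivity) ((hcos (p k)).trans h4) 2
      have h7 : a ^ 2 * ‖φ (p k) - o‖ ^ 2 ≤ α ^ 2 * hyperboloid T a o (φ (p k)) ^ 2 :=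
        calc a ^ 2 * ‖φ (p k) - o‖ ^ 2 = α ^ 2 * (Real.cos θ * ‖φ (p k) - o‖) ^ 2 := by
              rw [ha]; ring
          _ ≤ _ := by gcongr
      rw [mul_pow, hβ2]
      linarith
    have h6 : β * hyperboloid T a o (φ (p k)) ≤ T := le_of_sq_le_sq h5 hT.le
    have h7 : a ^ 2 * β ^ 3 / T ≤ a ^ 2 * T ^ 2 / hyperboloid T a o (φ (p k)) ^ 3 := by
      rw [div_le_div_iff₀ hT (by positivity)]
      have h8 := pow_le_pow_left₀ (by positivity) h6 3
      calc a ^ 2 * β ^ 3 * hyperboloid T a o (φ (p k)) ^ 3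
          = a ^ 2 * (β * hyperboloid T a o (φ (p k))) ^ 3 := by ring
        _ ≤ a ^ 2 * T ^ 3 := by gcongr
        _ = a ^ 2 * T ^ 2 * T := by ring
    have h8 := mul_le_mul_of_nonneg_right h7
      (sq_nonneg ‖fderiv ℝ (localRep φ (p k)) (extChartAt (𝓡 m) (p k) (p k)) w‖)
    have h9 : ‖(secondFundamentalForm φ (p k) w w : EuclideanSpace ℝ (Fin n))‖
        = ‖secondFundamentalForm φ (p k) w w‖ := rfl
    rw [h9] at h3
    -- The first-order term of the Hessian is at least -‖II(w, w)‖, so the convexity of f minus 1/k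
    -- must be compensated by ‖II(w, w)‖.
    linarith [h3.1]
  rw [div_le_iff₀ hT] at hmain
  calc α ^ 2 * β ^ 3 * Real.cos θ ^ 2 = a ^ 2 * β ^ 3 := by rw [ha]; ring
    _ ≤ χ * T := hmain

end Estimate

/-! ### The distance to the hyperplane and the constant A₁ -/

section Distance

variable {n : ℕ} {o v : EuclideanSpace ℝ (Fin n)}

theorem exists_height_lt_of_setDist_lt {S : Set (EuclideanSpace ℝ (Fin n))} (hS : S.Nonempty)
    (hv : ‖v‖ = 1) {T : ℝ} (hT : setDist (hyperplane o v) S < T) :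
    ∃ z ∈ S, ⟪v, z - o⟫ < T := by
  have : Nonempty (hyperplane o v) := ⟨o, by simp [hyperplane]⟩
  have : Nonempty S := hS.to_subtype
  obtain ⟨⟨⟨p, hp⟩, ⟨z, hz⟩⟩, h⟩ := exists_lt_of_ciInf_lt hT
  refine ⟨z, hz, lt_of_le_of_lt ?_ h⟩
  have hp' : ⟪v, p - o⟫ = 0 := (real_inner_comm _ _).trans hp
  calc ⟪v, z - o⟫ = ⟪v, z - p⟫ := by
        rw [← sub_add_sub_cancel z p o, inner_add_right, hp', add_zero]
    _ ≤ ‖v‖ * ‖z - p‖ := real_inner_le_norm _ _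
    _ = dist p z := by rw [hv, one_mul, dist_comm, dist_eq_norm]

theorem setDist_nonneg (S S' : Set (EuclideanSpace ℝ (Fin n))) : 0 ≤ setDist S S' :=
  Real.iInf_nonneg fun _ ↦ dist_nonneg

end Distance

section Constant

/-- If `C` bounds `α² (1 - α²)^{3/2}` for `α ∈ (0, 1)` then `0 < A₁ ≤ C`. -/
theorem constA_one_pos_and_le {C : ℝ}
    (hC : ∀ α : ℝ, 0 < α → α < 1 → α ^ 2 * √(1 - α ^ 2) ^ 3 ≤ C) :
    0 < constA 1 ∧ constA 1 ≤ C := by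
  have hub : ∀ t ∈ {t | ∃ ξ ∈ Set.Ioo (0 : ℝ) 1, ∃ α ∈ Set.Ioo (0 : ℝ) (min 1 (1 * √(1 - ξ))),
      t = ξ * α ^ 2 * √(1 - α ^ 2)}, t ≤ C := by
    rintro t ⟨ξ, hξ, α, ⟨hα0, hα⟩, rfl⟩
    rw [one_mul, lt_min_iff, Real.lt_sqrt hα0.le] at hα
    refine le_trans ?_ (hC α hα0 hα.1)
    have h1 : √(1 - α ^ 2) ^ 2 = 1 - α ^ 2 := Real.sq_sqrt (by linarith [hα.2, hξ.1])
    -- α < √(1 - ξ) amounts to ξ < 1 - α².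
    calc ξ * α ^ 2 * √(1 - α ^ 2) ≤ (1 - α ^ 2) * α ^ 2 * √(1 - α ^ 2) := by
          gcongr
          linarith [hα.2]
      _ = α ^ 2 * √(1 - α ^ 2) ^ 3 := by rw [pow_succ √(1 - α ^ 2) 2, h1]; ring
  have hmem : (1 / 2 : ℝ) * (1 / 2) ^ 2 * √(1 - (1 / 2) ^ 2) ∈
      {t | ∃ ξ ∈ Set.Ioo (0 : ℝ) 1, ∃ α ∈ Set.Ioo (0 : ℝ) (min 1 (1 * √(1 - ξ))),
        t = ξ * α ^ 2 * √(1 - α ^ 2)} := by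
    refine ⟨1 / 2, by norm_num, 1 / 2, ⟨by norm_num, ?_⟩, rfl⟩
    rw [one_mul, lt_min_iff, Real.lt_sqrt (by norm_num)]
    norm_num
  have hpos : (0 : ℝ) < (1 / 2 : ℝ) * (1 / 2) ^ 2 * √(1 - (1 / 2) ^ 2) :=
    mul_pos (by norm_num) (Real.sqrt_pos.2 (by norm_num))
  exact ⟨hpos.trans_le (le_csSup ⟨C, hub⟩ hmem), csSup_le ⟨_, hmem⟩ hub⟩

end Constant

end ConeImmersion

/-! ### Conclusion -/

theorem theorem2 {m n : ℕ} {M : Type*} [TopologicalSpace M] [T2Space M]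
    [SecondCountableTopology M] [ChartedSpace (EuclideanSpace ℝ (Fin m)) M]
    [IsManifold (𝓡 m) ∞ M]
    [RiemannianBundle (fun x : M ↦ TangentSpace (𝓡 m) x)]
    [IsContMDiffRiemannianBundle (𝓡 m) ∞ (EuclideanSpace ℝ (Fin m))
      (fun x : M ↦ TangentSpace (𝓡 m) x)]
    (hcod_pos : m < n) (hcod_lt : n - m < m)
    (hwmp : ConeImmersion.WeakMaximumPrincipleHessian m M)
    (χ : ℝ) (hχ : 0 ≤ χ) (hsec : ConeImmersion.SectionalCurvatureLE m M (χ ^ 2))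
    (φ : M → EuclideanSpace ℝ (Fin n)) (hφ : ConeImmersion.IsIsometricImmersion m φ)
    (o v : EuclideanSpace ℝ (Fin n)) (hv : ‖v‖ = 1)
    (θ : ℝ) (hθ : θ ∈ Set.Ioo 0 (Real.pi / 2))
    (hcone : Set.range φ ⊆ ConeImmersion.cone o v θ) :
    Real.cos θ ≤
      √(ConeImmersion.setDist (ConeImmersion.hyperplane o v) (Set.range φ)
        * (χ / ConeImmersion.constA 1)) := by

  have hcos : 0 < Real.cos θ :=
    Real.cos_pos_of_mem_Ioo ⟨by linarith [hθ.1, Real.pi_pos], hθ.2⟩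
  -- The maximum principle produces points even for a constant function, so M is nonempty.
  have hne : (Set.range φ).Nonempty := by
    obtain ⟨x, -⟩ := hwmp (fun _ ↦ 0) contMDiff_const ⟨0, by rintro _ ⟨_, rfl⟩; exact le_rfl⟩
    exact ⟨_, x 0, rfl⟩
  set d := ConeImmersion.setDist (ConeImmersion.hyperplane o v) (Set.range φ) with hd
  have hd0 : 0 ≤ d := ConeImmersion.setDist_nonneg _ _
  have hbound : ∀ α : ℝ, 0 < α → α < 1 →
      α ^ 2 * √(1 - α ^ 2) ^ 3 ≤ χ * d / Real.cos θ ^ 2 := by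
    intro α hα0 hα1
    rw [le_div_iff₀ (by positivity)]
    -- The estimate needs T > d, both for a point of height less than T and for T > 0 when d = 0;
    -- the value at d is reached as a limit from the right.
    have hlim : Filter.Tendsto (fun T : ℝ ↦ χ * T) (nhdsWithin d (Set.Ioi d)) (nhds (χ * d)) :=
      ((continuous_const_mul χ).tendsto d).mono_left nhdsWithin_le_nhds
    refine ge_of_tendsto hlim ?_
    filter_upwards [self_mem_nhdsWithin] with T hT
    obtain ⟨_, ⟨q, rfl⟩, hq⟩ := ConeImmersion.exists_height_lt_of_setDist_lt hne hv hT
    exact hφ.curvature_lower_bound (by omega) hwmp hχ hsec hv hcos hcone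
      (lt_of_le_of_lt hd0 hT) hq hα0 hα1
  obtain ⟨hA0, hA⟩ := ConeImmersion.constA_one_pos_and_le hbound
  refine Real.le_sqrt_of_sq_le ?_
  rw [mul_div_assoc', le_div_iff₀ hA0]
  rw [le_div_iff₀ (by positivity)] at hA
  linarith
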